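/- Let $\sigma:\mathbb R\to\mathbb R$ have slope restricted in $[0,1]$, i.e. $0\le\frac{\sigma(s)-\sigma(t)}{s-t}\le 1$ for all $s\ne t$. Consider an $L$-layer feed-through network (FTN) layer $\mathcal F:\mathbb R^n\to\mathbb R^n$, \[ z_k=\sigma(W_kz_{k-1}+U_kx+b_k)\ (1\le k\le L),\quad z_0=0,\qquad \mathcal F(x)=\mu x+\sum_{k=1}^L Y_kz_k+b_y , \] with $z_k\in\mathbb R^{m_k}$ and $\sigma$ applied entrywise. Stack the weights as $U=(U_1;\dots;U_L)$, $Y=(Y_1,\dots,Y_L)$, $b=(b_1;\dots;b_L)$, and let $W$ be the block matrix with blocks $W_2,\dots,W_L$ on the first block subdiagonal and zeros elsewhere. Let $\nu>\mu>0$, $\gamma=\nu-\mu$, $\tau=\nu/\mu$, and suppose that $\mathcal F$ is certified to be $\mu$-strongly monotone and $\nu$-Lipschitz, in the sense that a positive diagonal matrix $\Lambda$ is given with \[ Y=U^\top\Lambda,\qquad 2\Lambda-\Lambda W-W^\top\Lambda\succeq\tfrac2\gamma Y^\top Y . \] Put $\Psi=(2\Lambda)^{1/2}$, $V=\Psi W\Psi^{-1}$,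 $S=(2\gamma)^{-1/2}\Psi U$, $\hat b=\Psi b$, $\hat\sigma(v)=\Psi\sigma(\Psi^{-1}v)$, $\mathcal C(z)=\frac\gamma\mu SS^\top z$, and, for $y\in\mathbb R^n$, $b_z=\frac{\sqrt{2\gamma}}{\mu}S(y-b_y)+\hat b$ and $X_y(z)=\frac1\mu\bigl(y-b_y-\sqrt{\gamma/2}\,S^\top z\bigr)$. For $f:\mathbb R^m\to\mathbb R\cup\{\infty\}$, $m=m_1+\dots+m_L$, let $\mathbf{prox}_f^\alpha(v)=\arg\min_z\frac12\|v-z\|^2+\alpha f(z)$. Then: (a) $\mathcal C$ is $\frac{\mu}{2\gamma}$-cocoercive: $\langle\mathcal C(z)-\mathcal C(w),z-w\rangle\ge\frac{\mu}{2\gamma}\|\mathcal C(z)-\mathcal C(w)\|^2$ for all $z,w\in\mathbb R^m$. (b) There is a proper convex $f:\mathbb R^m\to\mathbb R\cup\{\infty\}$ with $\hat\sigma=\mathbf{prox}_f^1$. (c) For every $y\in\mathbb R^n$ the equation $\mathcal F(x)=y$ has a unique solution $x^\star=\mathcal F^{-1}(y)$, the equation $\hat z=\hat\sigma\bigl((V-\frac\gamma\mu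 SS^\top)\hat z+b_z\bigr)$ has a unique solution $\hat z\in\mathbb R^m$, and $x^\star=X_y(\hat z)$. Moreover, for every proper convex $f$ with $\hat\sigma=\mathbf{prox}_f^1$ and every step size $\alpha\in\bigl(0,\frac1{\tau-1}\bigr)$, $\mathbf{prox}_f^\alpha$ is single-valued and defined everywhere, $(1+\alpha)I-\alpha V$ is invertible, so that the Davis–Yin iteration \[ \begin{aligned} z^{k+1/2}&=\mathbf{prox}_f^\alpha(u^k), & u^{k+1/2}&=2z^{k+1/2}-u^k,\\ z^{k+1}&=R_{\mathcal A}\bigl(u^{k+1/2}-\alpha\,\mathcal C(z^{k+1/2})\bigr), & u^{k+1}&=u^k+z^{k+1}-z^{k+1/2}, \end{aligned} \] with $R_{\mathcal A}(v)=((1+\alpha)I-\alpha V)^{-1}(v+\alpha b_z)$, is well defined from every starting point $u^0\in\mathbb R^m$; and it converges from every $u^0$: $u^k$ converges to a point $u^\star$ with $\mathbf{prox}_f^\alpha(u^\star)=\hat z=R_{\mathcal A}\bigl(2\hat z-u^\star-\alpha\,\mathcal C(\hat z)\bigr)$ (a fixed point of the iteration), $z^{k+1/2}\to\hat z$, $z^k\to\hat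 z$, and hence $X_y(z^{k+1/2})\to\mathcal F^{-1}(y)$ and $X_y(z^k)\to\mathcal F^{-1}(y)$. -/

import Mathlib

open Filter Topology Matrix

/-- The scalar activation `σ` has slope restricted in `[0, 1]`. -/
def SlopeRestricted (σ : ℝ → ℝ) : Prop :=
  ∀ s t : ℝ, s ≠ t → 0 ≤ (σ s - σ t) / (s - t) ∧ (σ s - σ t) / (s - t) ≤ 1

/-- Weights and biases of a feed-through network (FTN) with input and output dimension `n`, with
`L` hidden layers, numbered `0, …, L - 1`, the `k`-th of them having width `m k`.
`W k` connects hidden layer `k` to hidden layer `k + 1`. Entries for layers `k ≥ L` are unused. -/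
structure FTN (n L : ℕ) (m : ℕ → ℕ) where
  W : (k : ℕ) → Matrix (Fin (m (k + 1))) (Fin (m k)) ℝ
  U : (k : ℕ) → Matrix (Fin (m k)) (Fin n) ℝ
  Y : (k : ℕ) → Matrix (Fin n) (Fin (m k)) ℝ
  b : (k : ℕ) → Fin (m k) → ℝ
  bOut : Fin n → ℝ

/-- Index set of the stacked hidden vector `z = (z_0, …, z_{L-1})`. -/
abbrev HiddenIdx (L : ℕ) (m : ℕ → ℕ) : Type := Σ k : Fin L, Fin (m k)

namespace FTN

variable {n L : ℕ} {m : ℕ → ℕ}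

/-- Hidden vectors: `z_0 = σ(U_0 x + b_0)` and `z_{k+1} = σ(W_k z_k + U_{k+1} x + b_{k+1})`,
with `σ` applied entrywise. -/
def hidden (N : FTN n L m) (σ : ℝ → ℝ) (x : Fin n → ℝ) : (k : ℕ) → Fin (m k) → ℝ
  | 0 => fun i => σ ((N.U 0 *ᵥ x + N.b 0) i)
  | k + 1 => fun i => σ ((N.W k *ᵥ hidden N σ x k + N.U (k + 1) *ᵥ x + N.b (k + 1)) i)

/-- The residual layer `F(x) = μ x + ∑ k, Y_k z_k + b_y`. -/
def layer (N : FTN n L m) (σ : ℝ → ℝ) (μ : ℝ) (x : Fin n → ℝ) : Fin n → ℝ :=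
  μ • x + ∑ k ∈ Finset.range L, N.Y k *ᵥ N.hidden σ x k + N.bOut

/-- The stacked (strictly block lower triangular) matrix `W`. -/
def bigW (N : FTN n L m) : Matrix (HiddenIdx L m) (HiddenIdx L m) ℝ :=
  fun i j => if h : (i.1 : ℕ) = j.1 + 1 then N.W j.1 (Fin.cast (by rw [h]) i.2) j.2 else 0

/-- The stacked matrix `U`. -/
def bigU (N : FTN n L m) : Matrix (HiddenIdx L m) (Fin n) ℝ := fun i j => N.U i.1 i.2 j

/-- The stacked matrix `Y`. -/
def bigY (N : FTN n L m) : Matrix (Fin n) (HiddenIdx L m) ℝ := fun i j => N.Y j.1 i j.2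

/-- The stacked bias `b`. -/
def bigB (N : FTN n L m) : HiddenIdx L m → ℝ := fun i => N.b i.1 i.2

/-- The semidefinite certificate, with multiplier `Λ = diag lam`, for the layer to be
`μ`-strongly monotone and `ν`-Lipschitz: `Λ` is positive, `Y = Uᵀ Λ` and
`2 Λ - Λ W - Wᵀ Λ ⪰ (2 / γ) Yᵀ Y`, where `γ = ν - μ`. -/
structure Certified (N : FTN n L m) (γ : ℝ) (lam : HiddenIdx L m → ℝ) : Prop where
  lam_pos : ∀ i, 0 < lam i
  Y_eq : N.bigY = N.bigUᵀ * diagonal lam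
  sdp : ((2 : ℝ) • diagonal lam - diagonal lam * N.bigW - N.bigWᵀ * diagonal lam
    - (2 / γ) • (N.bigYᵀ * N.bigY)).PosSemidef

/-- The diagonal of the scaling `Ψ`, given by `Λ = Ψ² / 2`. -/
noncomputable def psi (lam : HiddenIdx L m → ℝ) : HiddenIdx L m → ℝ :=
  fun i => Real.sqrt (2 * lam i)

/-- `V = Ψ W Ψ⁻¹`, that is `W = Ψ⁻¹ V Ψ`. -/
noncomputable def matV (N : FTN n L m) (lam : HiddenIdx L m → ℝ) :
    Matrix (HiddenIdx L m) (HiddenIdx L m) ℝ :=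
  diagonal (psi lam) * N.bigW * diagonal (fun i => (psi lam i)⁻¹)

/-- `S = (2 γ)^{-1/2} Ψ U`, that is `U = (2 γ)^{1/2} Ψ⁻¹ S`. -/
noncomputable def matS (N : FTN n L m) (γ : ℝ) (lam : HiddenIdx L m → ℝ) :
    Matrix (HiddenIdx L m) (Fin n) ℝ :=
  (1 / Real.sqrt (2 * γ)) • (diagonal (psi lam) * N.bigU)

/-- The rescaled activation `Ψ σ(Ψ⁻¹ v)`. -/
noncomputable def sigmaHat (σ : ℝ → ℝ) (lam : HiddenIdx L m → ℝ) (v : HiddenIdx L m → ℝ) :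
    HiddenIdx L m → ℝ :=
  fun i => psi lam i * σ ((psi lam i)⁻¹ * v i)

/-- `b_z = (√(2 γ) / μ) S (y - b_y) + Ψ b`. -/
noncomputable def biasZ (N : FTN n L m) (μ γ : ℝ) (lam : HiddenIdx L m → ℝ) (y : Fin n → ℝ) :
    HiddenIdx L m → ℝ :=
  (Real.sqrt (2 * γ) / μ) • (N.matS γ lam *ᵥ (y - N.bOut)) + diagonal (psi lam) *ᵥ N.bigB

/-- The matrix `(γ / μ) S Sᵀ` of the linear operator `C`. -/
noncomputable def matC (N : FTN n L m) (μ γ : ℝ) (lam : HiddenIdx L m → ℝ) :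
    Matrix (HiddenIdx L m) (HiddenIdx L m) ℝ :=
  (γ / μ) • (N.matS γ lam * (N.matS γ lam)ᵀ)

/-- The input `x = (1 / μ) (y - b_y - √(γ / 2) Sᵀ z)` read off from a hidden vector `z`. -/
noncomputable def readout (N : FTN n L m) (μ γ : ℝ) (lam : HiddenIdx L m → ℝ) (y : Fin n → ℝ)
    (z : HiddenIdx L m → ℝ) : Fin n → ℝ :=
  (1 / μ) • (y - N.bOut - Real.sqrt (γ / 2) • ((N.matS γ lam)ᵀ *ᵥ z))

/-- `z` solves the equilibrium equation `z = σ̂((V - (γ / μ) S Sᵀ) z + b_z)` of the inverse. -/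
def IsInverseState (N : FTN n L m) (σ : ℝ → ℝ) (μ γ : ℝ) (lam : HiddenIdx L m → ℝ)
    (y : Fin n → ℝ) (z : HiddenIdx L m → ℝ) : Prop :=
  z = sigmaHat σ lam ((N.matV lam - N.matC μ γ lam) *ᵥ z + N.biasZ μ γ lam y)

end FTN

section Splitting

variable {ι : Type*} [Fintype ι]

/-- `f : ℝ^ι → ℝ ∪ {∞}` is a proper convex function. -/
structure ProperConvex (f : (ι → ℝ) → EReal) : Prop where
  ne_bot : ∀ z, f z ≠ ⊥
  exists_ne_top : ∃ z, f z ≠ ⊤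
  convex : ∀ (z w : ι → ℝ) (a b : ℝ), 0 < a → 0 < b → a + b = 1 →
    f (a • z + b • w) ≤ (a : EReal) * f z + (b : EReal) * f w

/-- `p` minimizes `z ↦ ½ ‖v - z‖² + α f(z)` (Euclidean norm), that is `p` is a value of the
proximal operator of `f` with parameter `α` at `v`. -/
def IsProx (f : (ι → ℝ) → EReal) (α : ℝ) (v p : ι → ℝ) : Prop :=
  ∀ z : ι → ℝ, (((1 / 2) * ((v - p) ⬝ᵥ (v - p)) : ℝ) : EReal) + (α : EReal) * f p
    ≤ (((1 / 2) * ((v - z) ⬝ᵥ (v - z)) : ℝ) : EReal) + (α : EReal) * f z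

/-- The resolvent `v ↦ ((1 + α) I - α V)⁻¹ (v + α b_z)` of `A(z) = (I - V) z - b_z`. -/
noncomputable def resolventA [DecidableEq ι] (α : ℝ) (V : Matrix ι ι ℝ) (bz v : ι → ℝ) : ι → ℝ :=
  ((1 + α) • (1 : Matrix ι ι ℝ) - α • V)⁻¹ *ᵥ (v + α • bz)

/-- The sequences `u^k`, `z^{k+1/2}` (here `zHalf k`), `u^{k+1/2}` (here `uHalf k`) and `z^k` obey
the Davis–Yin iteration for `A(z) = (I - V) z - b_z`, `B = ∂f`, and the linear map with matrix `C`.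
The entry `z 0` plays no role. -/
structure IsDavisYin [DecidableEq ι] (f : (ι → ℝ) → EReal) (α : ℝ) (V C : Matrix ι ι ℝ)
    (bz : ι → ℝ) (u zHalf uHalf z : ℕ → ι → ℝ) : Prop where
  zHalf_prox : ∀ k, IsProx f α (u k) (zHalf k)
  uHalf_eq : ∀ k, uHalf k = (2 : ℝ) • zHalf k - u k
  z_succ : ∀ k, z (k + 1) = resolventA α V bz (uHalf k - α • (C *ᵥ zHalf k))
  u_succ : ∀ k, u (k + 1) = u k + z (k + 1) - zHalf k

/-- The map `T` on `ℝ^ι` is `β`-cocoercive (inverse monotone). -/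
def Cocoercive (β : ℝ) (T : (ι → ℝ) → ι → ℝ) : Prop :=
  ∀ z w, β * ((T z - T w) ⬝ᵥ (T z - T w)) ≤ (T z - T w) ⬝ᵥ (z - w)

end Splitting

/-! In the rescaled variables the certificate reads |Sᵀx|² ≤ |x|² - ⟨x, Vx⟩, and everything is drawn
from this inequality.

Flipping the sign of every second layer replaces ⟨x, Vx⟩ by its negative, because V links only
consecutive layers. Adding the two inequalities gives S Sᵀ ⪯ 2I, hence (a) (`cocoercive_matC`). The
certificate also gives ⟨x, Vx⟩ ≤ |x|², so the matrix of the resolvent is invertible and the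
resolvent is firmly nonexpansive. Combined with firm nonexpansiveness of σ̂, it makes the nonlinear
part of the layer 1/γ-cocoercive, so a gradient-type step is a contraction and the layer is
bijective (`existsUnique_layer_eq`). Eliminating x turns solutions of F(x) = y into solutions of the
equilibrium equation and back.

For (b), σ̂ is the gradient of a separable convex function with 1-Lipschitz gradient, and such
gradients are proximal maps (Moreau).

For the iteration, the Davis–Yin step satisfies a Fejér inequality when α < 2β, with β = μ/(2γ) and
2β = 1/(τ - 1). Its fixed points correspond to equilibrium states, so there is exactly one, and
compactness in finite dimension gives convergence. -/

/-! ### Euclidean geometry of `ι → ℝ` through the dot product -/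

section DotProduct

variable {ι : Type*} [Fintype ι]

lemma dotProduct_self_nonneg' (x : ι → ℝ) : 0 ≤ x ⬝ᵥ x :=
  Finset.sum_nonneg fun i _ => mul_self_nonneg (x i)

lemma sq_apply_le_dotProduct_self (x : ι → ℝ) (i : ι) : x i ^ 2 ≤ x ⬝ᵥ x := by
  rw [sq]
  exact Finset.single_le_sum (f := fun j => x j * x j) (fun j _ => mul_self_nonneg (x j))
    (Finset.mem_univ i)

lemma eq_of_dotProduct_sub_self_nonpos {x y : ι → ℝ} (h : (x - y) ⬝ᵥ (x - y) ≤ 0) : x = y :=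
  sub_eq_zero.1 (dotProduct_self_eq_zero.1 (le_antisymm h (dotProduct_self_nonneg' _)))

lemma sq_dotProduct_le (x y : ι → ℝ) : (x ⬝ᵥ y) ^ 2 ≤ (x ⬝ᵥ x) * (y ⬝ᵥ y) := by
  have := Finset.sum_mul_sq_le_sq_mul_sq Finset.univ x y
  simpa [dotProduct, sq] using this

lemma tendsto_of_dotProduct_sub_self {κ : Type*} {l : Filter κ} {u : κ → ι → ℝ} {a : ι → ℝ}
    (h : Tendsto (fun k => (u k - a) ⬝ᵥ (u k - a)) l (𝓝 0)) : Tendsto u l (𝓝 a) := by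
  rw [tendsto_pi_nhds]
  intro i
  have h1 : Tendsto (fun k => (u k i - a i) ^ 2) l (𝓝 0) :=
    squeeze_zero (fun k => sq_nonneg _) (fun k => sq_apply_le_dotProduct_self (u k - a) i) h
  have h2 : Tendsto (fun k => |u k i - a i|) l (𝓝 0) := by
    simpa [Real.sqrt_sq_eq_abs] using h1.sqrt
  exact tendsto_iff_norm_sub_tendsto_zero.2 h2

/-- Banach's fixed point theorem for the Euclidean distance on `ι → ℝ`. -/
lemma exists_fixedPoint_of_dotProduct_contraction {c : ℝ} (hc0 : 0 ≤ c) (hc : c < 1)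
    (T : (ι → ℝ) → ι → ℝ)
    (hT : ∀ x y, (T x - T y) ⬝ᵥ (T x - T y) ≤ c ^ 2 * ((x - y) ⬝ᵥ (x - y))) : ∃ x, T x = x := by
  have hd : ∀ x y : EuclideanSpace ℝ ι,
      dist x y ^ 2 = (x.ofLp - y.ofLp) ⬝ᵥ (x.ofLp - y.ofLp) := fun x y => by
    rw [EuclideanSpace.dist_eq, Real.sq_sqrt (Finset.sum_nonneg fun i _ => sq_nonneg _)]
    simp [dotProduct, Real.dist_eq, sq]
  let T' : EuclideanSpace ℝ ι → EuclideanSpace ℝ ι := fun x => WithLp.toLp 2 (T x.ofLp)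
  have hT' : ContractingWith ⟨c, hc0⟩ T' := by
    refine ⟨by exact_mod_cast hc, LipschitzWith.of_dist_le_mul fun x y => ?_⟩
    refine abs_le_of_sq_le_sq' ?_ (mul_nonneg hc0 dist_nonneg) |>.2
    rw [mul_pow, hd, hd]
    exact hT _ _
  exact ⟨(hT'.fixedPoint T').ofLp,
    congrArg WithLp.ofLp (hT'.fixedPoint_isFixedPt (f := T'))⟩

end DotProduct

/-! ### Firmly nonexpansive maps and Fejér monotonicity -/

section FirmlyNonexpansive

variable {ι : Type*} [Fintype ι]

/-- The map `J` on `ℝ^ι` is firmly nonexpansive. -/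
def FirmlyNonexpansive (J : (ι → ℝ) → ι → ℝ) : Prop :=
  ∀ u v, (J u - J v) ⬝ᵥ (J u - J v) ≤ (J u - J v) ⬝ᵥ (u - v)

lemma FirmlyNonexpansive.continuous {J : (ι → ℝ) → ι → ℝ} (hJ : FirmlyNonexpansive J) :
    Continuous J := by
  rw [continuous_iff_continuousAt]
  intro a
  refine tendsto_of_dotProduct_sub_self ?_
  have h : ∀ v, (J v - J a) ⬝ᵥ (J v - J a) ≤ (v - a) ⬝ᵥ (v - a) := fun v => by
    have h1 := hJ v a
    generalize J v - J a = p at *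
    generalize v - a = q at *
    have h2 := dotProduct_self_nonneg' (p - q)
    rw [sub_dotProduct, dotProduct_sub, dotProduct_sub, dotProduct_comm q p] at h2
    linarith
  refine squeeze_zero (fun v => dotProduct_self_nonneg' _) h ?_
  have : Continuous fun v : ι → ℝ => (v - a) ⬝ᵥ (v - a) := by fun_prop
  simpa using this.tendsto a

/-- A Fejér-type convergence theorem: iterates of a continuous map with a unique fixed point. -/
lemma tendsto_of_fejer {T : (ι → ℝ) → ι → ℝ} (hT : Continuous T) {a : ι → ℝ}
    (huniq : ∀ x, T x = x → x = a) {δ : ℝ} (hδ : 0 < δ)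
    (hfej : ∀ x, (T x - a) ⬝ᵥ (T x - a) + δ * ((T x - x) ⬝ᵥ (T x - x)) ≤ (x - a) ⬝ᵥ (x - a))
    {u : ℕ → ι → ℝ} (hu : ∀ k, u (k + 1) = T (u k)) : Tendsto u atTop (𝓝 a) := by
  set d : ℕ → ℝ := fun k => (u k - a) ⬝ᵥ (u k - a) with hd
  have hd0 : ∀ k, 0 ≤ d k := fun k => dotProduct_self_nonneg' _
  have hstep : ∀ k, d (k + 1) + δ * ((T (u k) - u k) ⬝ᵥ (T (u k) - u k)) ≤ d k := fun k => by
    simpa [hd, hu k] using hfej (u k)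
  have hanti : Antitone d := antitone_nat_of_succ_le fun k => by
    have := hstep k
    have := mul_nonneg hδ.le (dotProduct_self_nonneg' (T (u k) - u k))
    linarith
  have hlim : Tendsto d atTop (𝓝 (⨅ k, d k)) :=
    tendsto_atTop_ciInf hanti ⟨0, by rintro _ ⟨k, rfl⟩; exact hd0 k⟩
  have hres : Tendsto (fun k => (T (u k) - u k) ⬝ᵥ (T (u k) - u k)) atTop (𝓝 0) := by
    have h1 : Tendsto (fun k => (d k - d (k + 1)) / δ) atTop (𝓝 0) := by
      simpa using (hlim.sub (hlim.comp (tendsto_add_atTop_nat 1))).div_const δ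
    refine squeeze_zero (fun k => dotProduct_self_nonneg' _) (fun k => ?_) h1
    rw [le_div_iff₀ hδ]
    have := hstep k
    linarith
  -- `ι → ℝ` carries the sup metric, so the Euclidean bound is used coordinate by coordinate.
  have hbdd : ∀ k, u k ∈ Metric.closedBall a (Real.sqrt (d 0)) := fun k => by
    rw [Metric.mem_closedBall, dist_pi_le_iff (Real.sqrt_nonneg _)]
    intro i
    rw [Real.dist_eq, ← Real.sqrt_sq_eq_abs]
    exact Real.sqrt_le_sqrt
      ((sq_apply_le_dotProduct_self (u k - a) i).trans (hanti (Nat.zero_le k)))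
  obtain ⟨b, -, φ, hφ, hb⟩ := tendsto_subseq_of_bounded Metric.isBounded_closedBall hbdd
  have hfix : T b = b := by
    have hc : Continuous fun x => (T x - x) ⬝ᵥ (T x - x) := by fun_prop
    have h1 := (hc.tendsto b).comp hb
    have h2 := tendsto_nhds_unique h1 (hres.comp hφ.tendsto_atTop)
    exact eq_of_dotProduct_sub_self_nonpos h2.le
  obtain rfl := huniq b hfix
  have hc : Continuous fun x => (x - b) ⬝ᵥ (x - b) := by fun_prop
  have h0 : Tendsto (d ∘ φ) atTop (𝓝 0) := by
    have := (hc.tendsto b).comp hb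
    rwa [sub_self, dotProduct_zero] at this
  -- The monotone sequence `d` has a limit, and along `φ` that limit is 0; so the whole sequence
  -- converges.
  have h1 := tendsto_nhds_unique h0 (hlim.comp hφ.tendsto_atTop)
  refine tendsto_of_dotProduct_sub_self ?_
  rw [h1]
  exact hlim

/-- One step of Davis–Yin splitting brings every point closer to a fixed point. -/
lemma davisYin_fejer {J R C : (ι → ℝ) → ι → ℝ} (hJ : FirmlyNonexpansive J)
    (hR : FirmlyNonexpansive R) {β α : ℝ} (hβ : 0 < β) (hα : 0 < α) (hC : Cocoercive β C)
    {a : ι → ℝ} (ha : R ((2 : ℝ) • J a - a - α • C (J a)) = J a) (x : ι → ℝ) :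
    ((x + R ((2 : ℝ) • J x - x - α • C (J x)) - J x) - a) ⬝ᵥ
        ((x + R ((2 : ℝ) • J x - x - α • C (J x)) - J x) - a)
      + (1 - α / (2 * β)) * (((x + R ((2 : ℝ) • J x - x - α • C (J x)) - J x) - x) ⬝ᵥ
        ((x + R ((2 : ℝ) • J x - x - α • C (J x)) - J x) - x)) ≤ (x - a) ⬝ᵥ (x - a) := by
  have h1 := hJ x a
  have h2 := hR ((2 : ℝ) • J x - x - α • C (J x)) ((2 : ℝ) • J a - a - α • C (J a))
  have h3 := hC (J x) (J a)
  rw [ha] at h2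
  set r := R ((2 : ℝ) • J x - x - α • C (J x))
  obtain ⟨d, hd⟩ : ∃ d, d = x - a := ⟨_, rfl⟩
  obtain ⟨p, hp⟩ : ∃ p, p = J x - J a := ⟨_, rfl⟩
  obtain ⟨q, hq⟩ : ∃ q, q = r - J a := ⟨_, rfl⟩
  obtain ⟨c, hc⟩ : ∃ c, c = C (J x) - C (J a) := ⟨_, rfl⟩
  have e1 : x + r - J x - a = d + q - p := by rw [hd, hq, hp]; abel
  have e2 : x + r - J x - x = q - p := by rw [hq, hp]; abel
  have e3 : (2 : ℝ) • J x - x - α • C (J x) - ((2 : ℝ) • J a - a - α • C (J a))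
      = (2 : ℝ) • p - d - α • c := by rw [hp, hd, hc]; module
  rw [e3] at h2
  rw [e1, e2, ← hd]
  rw [← hd, ← hp] at h1
  rw [← hq] at h2
  rw [← hc, ← hp] at h3
  -- After `h1`, `h2` and cocoercivity, what remains is exactly α/(2β) times this square; the factor
  -- 2β on `c` completes it.
  have h4 := dotProduct_self_nonneg' ((q - p) + (2 * β) • c)
  simp only [sub_dotProduct, dotProduct_sub, add_dotProduct, dotProduct_add, smul_dotProduct,
    dotProduct_smul, smul_eq_mul] at h1 h2 h3 h4 ⊢
  simp only [dotProduct_comm p q, dotProduct_comm c p, dotProduct_comm c q, dotProduct_comm p d,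
    dotProduct_comm q d] at h1 h2 h3 h4 ⊢
  have h5 := mul_le_mul_of_nonneg_left h3 (by positivity : 0 ≤ 2 * α)
  have h6 := mul_nonneg (by positivity : 0 ≤ α / (2 * β)) h4
  have e : α / (2 * β) * (q ⬝ᵥ q - q ⬝ᵥ p - (q ⬝ᵥ p - p ⬝ᵥ p) + 2 * β * (q ⬝ᵥ c - p ⬝ᵥ c)
      + 2 * β * (q ⬝ᵥ c - p ⬝ᵥ c + 2 * β * c ⬝ᵥ c)) =
      α / (2 * β) * (q ⬝ᵥ q - q ⬝ᵥ p - (q ⬝ᵥ p - p ⬝ᵥ p)) + 2 * α * (q ⬝ᵥ c - p ⬝ᵥ c)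
        + 2 * α * (β * c ⬝ᵥ c) := by
    field_simp; ring
  linarith

end FirmlyNonexpansive

/-! ### Scalar activations with slope in [0, 1] -/

section SlopeRestricted

/-- A division-free form: firm nonexpansiveness on the line, which sums over coordinates. -/
lemma slopeRestricted_iff {σ : ℝ → ℝ} :
    SlopeRestricted σ ↔ ∀ s t, (σ s - σ t) ^ 2 ≤ (σ s - σ t) * (s - t) := by
  constructor
  · intro h s t
    rcases eq_or_ne s t with rfl | hst
    · simp
    · obtain ⟨h0, h1⟩ := h s t hst
      have hne : s - t ≠ 0 := sub_ne_zero.2 hst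
      obtain ⟨c, hc⟩ : ∃ c, c = (σ s - σ t) / (s - t) := ⟨_, rfl⟩
      have e : σ s - σ t = c * (s - t) := by rw [hc, div_mul_cancel₀ _ hne]
      rw [← hc] at h0 h1
      rw [e]
      nlinarith [mul_nonneg (mul_nonneg h0 (sub_nonneg.2 h1)) (sq_nonneg (s - t))]
  · intro h s t hst
    have hpos : 0 < (s - t) ^ 2 := by have := sub_ne_zero.2 hst; positivity
    have h1 := h s t
    have e : (σ s - σ t) / (s - t) = (σ s - σ t) * (s - t) / (s - t) ^ 2 := by
      have := sub_ne_zero.2 hst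
      field_simp
    rw [e, div_le_one hpos]
    refine ⟨div_nonneg ((sq_nonneg _).trans h1) hpos.le, ?_⟩
    nlinarith [sq_nonneg ((σ s - σ t) - (s - t))]

lemma SlopeRestricted.monotone {σ : ℝ → ℝ} (h : SlopeRestricted σ) : Monotone σ := by
  intro s t hst
  by_contra! hlt
  have := slopeRestricted_iff.1 h s t
  nlinarith

lemma SlopeRestricted.abs_sub_le {σ : ℝ → ℝ} (h : SlopeRestricted σ) (s t : ℝ) :
    |σ s - σ t| ≤ |s - t| := by
  have := slopeRestricted_iff.1 h s t
  refine sq_le_sq.1 ?_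
  nlinarith [sq_nonneg ((σ s - σ t) - (s - t))]

lemma SlopeRestricted.continuous {σ : ℝ → ℝ} (h : SlopeRestricted σ) : Continuous σ :=
  (LipschitzWith.of_dist_le_mul (K := 1) fun s t => by
    simpa [Real.dist_eq] using h.abs_sub_le s t).continuous

lemma SlopeRestricted.rescale {σ : ℝ → ℝ} (h : SlopeRestricted σ) {c : ℝ} (hc : 0 < c) :
    SlopeRestricted fun t => c * σ (c⁻¹ * t) := by
  rw [slopeRestricted_iff] at h ⊢
  intro s t
  have h1 := mul_le_mul_of_nonneg_left (h (c⁻¹ * s) (c⁻¹ * t)) (sq_nonneg c)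
  calc _ = c ^ 2 * (σ (c⁻¹ * s) - σ (c⁻¹ * t)) ^ 2 := by ring
    _ ≤ _ := h1
    _ = _ := by field_simp

/-- Every slope of this map is a convex combination of 1 and α, hence at least min(α, 1) > 0; a
continuous map growing at least linearly is onto. -/
lemma SlopeRestricted.surjective_interp {σ : ℝ → ℝ} (h : SlopeRestricted σ) {α : ℝ} (hα : 0 < α) :
    Function.Surjective fun t => σ t + α * (t - σ t) := by
  have hcont : Continuous fun t => σ t + α * (t - σ t) := by
    have := h.continuous
    fun_prop
  obtain ⟨c, hc0, hcα, hc1⟩ : ∃ c : ℝ, 0 < c ∧ c ≤ α ∧ c ≤ 1 :=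
    ⟨min α 1, lt_min hα one_pos, min_le_left _ _, min_le_right _ _⟩
  have key : ∀ s t, s ≤ t →
      c * (t - s) ≤ σ t + α * (t - σ t) - (σ s + α * (s - σ s)) := fun s t hst => by
    have h1 := h.monotone hst
    have h2 := (abs_le.1 ((h.abs_sub_le t s).trans_eq (abs_of_nonneg (sub_nonneg.2 hst)))).2
    nlinarith [mul_nonneg (sub_nonneg.2 hcα) (sub_nonneg.2 h2),
      mul_nonneg (sub_nonneg.2 hc1) (sub_nonneg.2 h1)]
  refine hcont.surjective ?_ ?_
  · refine tendsto_atTop_mono' atTop (f₁ := fun t => c * t + (σ 0 + α * (0 - σ 0))) ?_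
      (tendsto_atTop_add_const_right _ _ (tendsto_id.const_mul_atTop hc0))
    filter_upwards [eventually_ge_atTop 0] with t ht
    linarith [key 0 t ht]
  · refine tendsto_atBot_mono' atBot (f₁ := fun t => c * t + (σ 0 + α * (0 - σ 0))) ?_
      (tendsto_atBot_add_const_right _ _ (tendsto_id.const_mul_atBot hc0))
    filter_upwards [eventually_le_atBot 0] with t ht
    linarith [key t 0 ht]

lemma Monotone.mul_sub_le_integral {σ : ℝ → ℝ} (h : Monotone σ) (v x : ℝ) :
    σ v * (x - v) ≤ ∫ t in v..x, σ t := by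
  rcases le_total v x with hvx | hvx
  · have := intervalIntegral.integral_mono_on (μ := MeasureTheory.volume) hvx (f := fun _ => σ v) (g := σ)
      intervalIntegrable_const h.intervalIntegrable (fun t ht => h ht.1)
    simpa [mul_comm] using this
  · have := intervalIntegral.integral_mono_on (μ := MeasureTheory.volume) hvx (f := σ) (g := fun _ => σ v)
      h.intervalIntegrable intervalIntegrable_const (fun t ht => h ht.2)
    rw [intervalIntegral.integral_symm]
    simp at this
    linarith

/-- The primitive of a slope restricted function is cocoercive in the Baillon–Haddad sense. -/
lemma SlopeRestricted.half_sq_le_integral {σ : ℝ → ℝ} (h : SlopeRestricted σ) (v w : ℝ) :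
    σ v * (w - v) + 1 / 2 * (σ w - σ v) ^ 2 ≤ ∫ t in v..w, σ t := by
  have hm' : Monotone fun t => t - σ t := fun s t hst => by
    have h2 := (abs_le.1 ((h.abs_sub_le t s).trans_eq (abs_of_nonneg (sub_nonneg.2 hst)))).2
    dsimp only
    linarith
  -- Baillon–Haddad argument: `x` is a unit gradient step from `w` for the primitive of σ minus its
  -- tangent at `v`. The tangent inequality for σ at `v` and that for t - σ(t) at `w`, both
  -- evaluated at `x`, combine to the claim.
  obtain ⟨x, hx⟩ : ∃ x, x = w - (σ w - σ v) := ⟨_, rfl⟩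
  have h1 := h.monotone.mul_sub_le_integral v x
  have h2 := hm'.mul_sub_le_integral w x
  have hi : ∀ a b, IntervalIntegrable σ MeasureTheory.volume a b :=
    fun a b => h.monotone.intervalIntegrable
  rw [intervalIntegral.integral_sub (by simp) (hi _ _), integral_id] at h2
  have h3 := intervalIntegral.integral_add_adjacent_intervals (hi v w) (hi w x)
  have e : x - w = -(σ w - σ v) := by rw [hx]; ring
  have e' : x - v = (w - v) - (σ w - σ v) := by rw [hx]; ring
  have e2 : x ^ 2 - w ^ 2 = (x - w) * (2 * w + (x - w)) := by ring
  rw [e2, e] at h2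
  rw [e'] at h1
  nlinarith

end SlopeRestricted

/-! ### Proximal operators of proper convex functions -/

section Prox

variable {ι : Type*} [Fintype ι]

lemma half_dotProduct_sub_expand (v p z : ι → ℝ) :
    1 / 2 * ((v - z) ⬝ᵥ (v - z)) = 1 / 2 * ((v - p) ⬝ᵥ (v - p)) - (v - p) ⬝ᵥ (z - p)
      + 1 / 2 * ((z - p) ⬝ᵥ (z - p)) := by
  have e : v - z = (v - p) - (z - p) := by abel
  rw [e]
  generalize v - p = a
  generalize z - p = b
  rw [sub_dotProduct, dotProduct_sub, dotProduct_sub, dotProduct_comm b a]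
  ring

/-- Optimality condition characterizing the proximal points of a proper convex function. -/
lemma isProx_iff {f : (ι → ℝ) → EReal} (hf : ProperConvex f) {α : ℝ} (hα : 0 < α) {v p : ι → ℝ} :
    IsProx f α v p ↔ f p ≠ ⊤ ∧
      ∀ z, f z ≠ ⊤ → (v - p) ⬝ᵥ (z - p) ≤ α * ((f z).toReal - (f p).toReal) := by
  have hco : ∀ z, f z ≠ ⊤ → ((f z).toReal : EReal) = f z :=
    fun z hz => EReal.coe_toReal hz (hf.ne_bot z)
  constructor
  · intro h
    have hp : f p ≠ ⊤ := by
      obtain ⟨z, hz⟩ := hf.exists_ne_top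
      intro hp
      have h1 := h z
      rw [hp, EReal.coe_mul_top_of_pos hα, EReal.coe_add_top, ← hco z hz] at h1
      exact absurd h1 (not_le.2 (by exact_mod_cast EReal.coe_lt_top _))
    refine ⟨hp, fun z hz => ?_⟩
    -- Compare `p` with the point (1 - t)p + tz, divide by t, then let t → 0 to remove the quadratic
    -- term.
    have key : ∀ t : ℝ, 0 < t → t < 1 →
        (v - p) ⬝ᵥ (z - p) ≤
          α * ((f z).toReal - (f p).toReal) + t * (1 / 2 * ((z - p) ⬝ᵥ (z - p))) := by
      intro t ht0 ht1
      have hc := hf.convex p z (1 - t) t (by linarith) ht0 (by ring)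
      rw [← hco z hz, ← hco p hp] at hc
      have hw : f ((1 - t) • p + t • z) ≠ ⊤ := by
        refine ne_top_of_le_ne_top ?_ hc
        exact_mod_cast EReal.coe_ne_top _
      have h1 := h ((1 - t) • p + t • z)
      rw [← hco _ hw] at hc
      rw [← hco _ hw, ← hco p hp] at h1
      norm_cast at hc h1
      rw [half_dotProduct_sub_expand v p ((1 - t) • p + t • z)] at h1
      have e : (1 - t) • p + t • z - p = t • (z - p) := by module
      rw [e] at h1
      simp only [smul_dotProduct, dotProduct_smul, smul_eq_mul] at h1
      have h2 := mul_le_mul_of_nonneg_left hc hα.le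
      refine le_of_mul_le_mul_left ?_ ht0
      linarith
    have hlim : Tendsto (fun t : ℝ => α * ((f z).toReal - (f p).toReal)
        + t * (1 / 2 * ((z - p) ⬝ᵥ (z - p)))) (𝓝[>] 0)
        (𝓝 (α * ((f z).toReal - (f p).toReal))) := by
      have : Continuous fun t : ℝ => α * ((f z).toReal - (f p).toReal)
        + t * (1 / 2 * ((z - p) ⬝ᵥ (z - p))) := by fun_prop
      simpa using (this.tendsto 0).mono_left nhdsWithin_le_nhds
    refine ge_of_tendsto hlim ?_
    filter_upwards [Ioo_mem_nhdsGT one_pos] with t ht using key t ht.1 ht.2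
  · rintro ⟨hp, h⟩ z
    by_cases hz : f z = ⊤
    · rw [hz, EReal.coe_mul_top_of_pos hα, EReal.coe_add_top]
      exact le_top
    · have h1 := h z hz
      rw [← hco z hz, ← hco p hp]
      norm_cast
      rw [half_dotProduct_sub_expand v p z]
      linarith [dotProduct_self_nonneg' (z - p)]

lemma IsProx.unique {f : (ι → ℝ) → EReal} (hf : ProperConvex f) {α : ℝ} (hα : 0 < α)
    {v p q : ι → ℝ} (hp : IsProx f α v p) (hq : IsProx f α v q) : p = q := by
  obtain ⟨hp0, hp⟩ := (isProx_iff hf hα).1 hp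
  obtain ⟨hq0, hq⟩ := (isProx_iff hf hα).1 hq
  have h1 := hp q hq0
  have h2 := hq p hp0
  apply eq_of_dotProduct_sub_self_nonpos
  have e : (p - q) ⬝ᵥ (p - q) = (v - p) ⬝ᵥ (q - p) + (v - q) ⬝ᵥ (p - q) := by
    have : q - p = -(p - q) := by abel
    rw [this, dotProduct_neg, ← neg_dotProduct, ← add_dotProduct]
    congr 1
    abel
  linarith

lemma isProx_firmlyNonexpansive {f : (ι → ℝ) → EReal} (hf : ProperConvex f) {α : ℝ} (hα : 0 < α)
    {J : (ι → ℝ) → ι → ℝ} (hJ : ∀ v, IsProx f α v (J v)) : FirmlyNonexpansive J := by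
  intro u v
  obtain ⟨hp0, hp⟩ := (isProx_iff hf hα).1 (hJ u)
  obtain ⟨hq0, hq⟩ := (isProx_iff hf hα).1 (hJ v)
  have h1 := hp _ hq0
  have h2 := hq _ hp0
  have e : (J u - J v) ⬝ᵥ (u - v) - (J u - J v) ⬝ᵥ (J u - J v) =
      -((u - J u) ⬝ᵥ (J v - J u) + (v - J v) ⬝ᵥ (J u - J v)) := by
    have : J v - J u = -(J u - J v) := by abel
    rw [this, dotProduct_neg, ← neg_dotProduct, ← add_dotProduct, ← dotProduct_sub,
      dotProduct_comm, ← neg_dotProduct]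
    congr 1
    abel
  linarith

/-- A proximal point with parameter `1` is a proximal point with parameter `α` of a shifted
argument. -/
lemma IsProx.change_parameter {f : (ι → ℝ) → EReal} (hf : ProperConvex f) {α : ℝ} (hα : 0 < α)
    {v p : ι → ℝ} (h : IsProx f 1 v p) : IsProx f α (p + α • (v - p)) p := by
  obtain ⟨hp0, hp⟩ := (isProx_iff hf one_pos).1 h
  refine (isProx_iff hf hα).2 ⟨hp0, fun z hz => ?_⟩
  rw [add_sub_cancel_left, smul_dotProduct, smul_eq_mul]
  have := hp z hz
  exact mul_le_mul_of_nonneg_left (by linarith) hα.le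

/-- Since `f` need not be lower semicontinuous, existence of minimizers is not automatic. It is
inherited from parameter 1: `IsProx.change_parameter` solves the problem at every point of the form
P(u) + α(u - P(u)), where P is the prox with parameter 1, and these points fill the space. -/
lemma existsUnique_isProx {s : ι → ℝ → ℝ} (hs : ∀ i, SlopeRestricted (s i))
    {f : (ι → ℝ) → EReal} (hf : ProperConvex f)
    (h1 : ∀ v : ι → ℝ, IsProx f 1 v fun i => s i (v i)) {α : ℝ} (hα : 0 < α) (v : ι → ℝ) :
    ∃! p, IsProx f α v p := by
  choose u hu using fun i => (hs i).surjective_interp hα (v i)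
  have h2 := (h1 u).change_parameter hf hα
  have e : (fun i => s i (u i)) + α • (u - fun i => s i (u i)) = v := funext hu
  rw [e] at h2
  exact ⟨_, h2, fun q hq => hq.unique hf hα h2⟩

/-- A separable slope restricted map is the proximal operator of a proper convex function. -/
lemma exists_properConvex_isProx {s : ι → ℝ → ℝ} (hs : ∀ i, SlopeRestricted (s i)) :
    ∃ f : (ι → ℝ) → EReal, ProperConvex f ∧ ∀ v : ι → ℝ, IsProx f 1 v fun i => s i (v i) := by
  let P : (ι → ℝ) → ι → ℝ := fun v i => s i (v i)
  let g : (ι → ℝ) → ℝ := fun v => ∑ i, ∫ t in (0 : ℝ)..v i, s i t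
  -- Since `P` is the gradient of `g`, v - P(v) should be a subgradient of `f` at P(v). So `f` is
  -- taken as a supremum of functions affine in z with these slopes; `hg` says exactly that the one
  -- indexed by `v` attains the supremum at P(v).
  let a : (ι → ℝ) → (ι → ℝ) → ℝ := fun v z => 1 / 2 * (P v ⬝ᵥ P v) - g v + (v - P v) ⬝ᵥ z
  have hg : ∀ v w, P v ⬝ᵥ (w - v) + 1 / 2 * ((P w - P v) ⬝ᵥ (P w - P v)) ≤ g w - g v := by
    intro v w
    simp only [g, dotProduct, Finset.mul_sum, ← Finset.sum_add_distrib, ← Finset.sum_sub_distrib]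
    refine Finset.sum_le_sum fun i _ => ?_
    rw [intervalIntegral.integral_interval_sub_left (hs i).monotone.intervalIntegrable
      (hs i).monotone.intervalIntegrable]
    have := (hs i).half_sq_le_integral (v i) (w i)
    simpa [P, sq] using this
  let f : (ι → ℝ) → EReal := fun z => ⨆ v, ((a v z : ℝ) : EReal)
  have hle : ∀ v z, ((a v z : ℝ) : EReal) ≤ f z := fun v z =>
    le_iSup (fun v => ((a v z : ℝ) : EReal)) v
  have hfP : ∀ v, f (P v) = ((a v (P v) : ℝ) : EReal) := fun v => by
    refine le_antisymm (iSup_le fun w => ?_) (hle v (P v))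
    rw [EReal.coe_le_coe_iff]
    have := hg v w
    simp only [a]
    simp only [sub_dotProduct, dotProduct_sub] at this ⊢
    rw [dotProduct_comm (P w) (P v), dotProduct_comm w, dotProduct_comm v] at *
    linarith
  have hbot : ∀ z, f z ≠ ⊥ := fun z h => by
    have := hle 0 z
    rw [h] at this
    exact absurd this (not_le.2 (EReal.bot_lt_coe _))
  have hf : ProperConvex f := by
    refine ⟨hbot, ⟨P 0, by rw [hfP]; exact EReal.coe_ne_top _⟩, ?_⟩
    intro z w b c hb hc hbc
    refine iSup_le fun v => ?_
    have e : a v (b • z + c • w) = b * a v z + c * a v w := by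
      simp only [a, dotProduct_add, dotProduct_smul, smul_eq_mul]
      have : b = 1 - c := by linarith
      subst this
      ring
    rw [e, EReal.coe_add, EReal.coe_mul, EReal.coe_mul]
    exact add_le_add (mul_le_mul_of_nonneg_left (hle v z) (by exact_mod_cast hb.le))
      (mul_le_mul_of_nonneg_left (hle v w) (by exact_mod_cast hc.le))
  refine ⟨f, hf, fun v => (isProx_iff hf one_pos).2 ⟨?_, fun z hz => ?_⟩⟩
  · change f (P v) ≠ ⊤
    rw [hfP]
    exact EReal.coe_ne_top _
  · change (v - P v) ⬝ᵥ (z - P v) ≤ 1 * ((f z).toReal - (f (P v)).toReal)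
    have h1 := hle v z
    rw [← EReal.coe_toReal hz (hbot z), EReal.coe_le_coe_iff] at h1
    rw [hfP, EReal.toReal_coe, dotProduct_sub]
    simp only [a] at h1 ⊢
    linarith

end Prox

/-! ### The stacked network, its rescaling and the certificate -/

namespace FTN

variable {n L : ℕ} {m : ℕ → ℕ}

section Stacking

/-- Stacking of a family of hidden vectors. -/
def stack (L : ℕ) (h : (k : ℕ) → Fin (m k) → ℝ) : HiddenIdx L m → ℝ := fun i => h i.1 i.2

lemma bigW_mulVec_zero (N : FTN n L m) (w : HiddenIdx L m → ℝ) (h : 0 < L) (i : Fin (m 0)) :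
    (N.bigW *ᵥ w) ⟨⟨0, h⟩, i⟩ = 0 :=
  Finset.sum_eq_zero fun j _ => by simp [bigW]

lemma bigW_mulVec_succ (N : FTN n L m) (w : HiddenIdx L m → ℝ) (k : ℕ) (h : k + 1 < L)
    (i : Fin (m (k + 1))) :
    (N.bigW *ᵥ w) ⟨⟨k + 1, h⟩, i⟩
      = (N.W k *ᵥ fun j => w ⟨⟨k, Nat.lt_of_succ_lt h⟩, j⟩) i := by
  simp only [mulVec, dotProduct]
  rw [Fintype.sum_sigma, Finset.sum_eq_single ⟨k, Nat.lt_of_succ_lt h⟩]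
  · simp [bigW]
  · intro l _ hl
    refine Finset.sum_eq_zero fun j _ => ?_
    have : k ≠ (l : ℕ) := fun e => hl (Fin.ext e.symm)
    simp [bigW, this]
  · simp

/-- The stacked hidden vector is the unique solution of the implicit equation
`w = σ(W w + U x + b)`. -/
lemma eq_stack_hidden_iff (N : FTN n L m) (σ : ℝ → ℝ) (x : Fin n → ℝ) (w : HiddenIdx L m → ℝ) :
    w = stack L (N.hidden σ x) ↔
      ∀ i, w i = σ ((N.bigW *ᵥ w) i + (N.bigU *ᵥ x) i + N.bigB i) := by
  constructor
  · rintro rfl ⟨⟨k, hk⟩, i⟩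
    cases k with
    | zero =>
      rw [bigW_mulVec_zero, zero_add]
      rfl
    | succ k =>
      rw [bigW_mulVec_succ]
      rfl
  · intro h
    have key : ∀ (k : ℕ) (hk : k < L) (i : Fin (m k)), w ⟨⟨k, hk⟩, i⟩ = N.hidden σ x k i := by
      intro k
      induction k with
      | zero =>
        intro hk i
        rw [h, bigW_mulVec_zero, zero_add]
        rfl
      | succ k ih =>
        intro hk i
        rw [h, bigW_mulVec_succ, funext (ih (Nat.lt_of_succ_lt hk))]
        rfl
    exact funext fun i => key i.1 i.1.2 i.2

lemma bigY_mulVec_stack (N : FTN n L m) (h : (k : ℕ) → Fin (m k) → ℝ) :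
    N.bigY *ᵥ stack L h = ∑ k ∈ Finset.range L, N.Y k *ᵥ h k := by
  ext i
  rw [Finset.sum_range, Finset.sum_apply]
  simp only [mulVec, dotProduct]
  rw [Fintype.sum_sigma]
  rfl

/-- The change of sign of every second layer. -/
def signFlip (x : HiddenIdx L m → ℝ) : HiddenIdx L m → ℝ := fun i => (-1) ^ (i.1 : ℕ) * x i

lemma signFlip_dotProduct_self (x : HiddenIdx L m → ℝ) : signFlip x ⬝ᵥ signFlip x = x ⬝ᵥ x := by
  refine Finset.sum_congr rfl fun i _ => ?_
  rcases neg_one_pow_eq_or ℝ (i.1 : ℕ) with h | h <;> simp [signFlip, h]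

end Stacking

section Scaling

variable {lam : HiddenIdx L m → ℝ}

lemma psi_pos (h : ∀ i, 0 < lam i) (i : HiddenIdx L m) : 0 < psi lam i :=
  Real.sqrt_pos.2 (by have := h i; linarith)

lemma psi_mul_self (h : ∀ i, 0 < lam i) (i : HiddenIdx L m) : psi lam i * psi lam i = 2 * lam i :=
  Real.mul_self_sqrt (by have := h i; linarith)

lemma matV_mulVec (N : FTN n L m) (z : HiddenIdx L m → ℝ) (i : HiddenIdx L m) :
    (N.matV lam *ᵥ z) i = psi lam i * (N.bigW *ᵥ fun j => (psi lam j)⁻¹ * z j) i := by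
  rw [matV, ← mulVec_mulVec, ← mulVec_mulVec, mulVec_diagonal]
  congr 2
  ext j
  rw [mulVec_diagonal]

/-- Nonzero entries of V join layers of opposite parity, so each term of the quadratic form changes
sign. -/
lemma signFlip_matV (N : FTN n L m) (x : HiddenIdx L m → ℝ) :
    signFlip x ⬝ᵥ (N.matV lam *ᵥ signFlip x) = -(x ⬝ᵥ (N.matV lam *ᵥ x)) := by
  simp only [dotProduct, mulVec, Finset.mul_sum, ← Finset.sum_neg_distrib]
  refine Finset.sum_congr rfl fun i _ => Finset.sum_congr rfl fun j _ => ?_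
  by_cases h : (i.1 : ℕ) = j.1 + 1
  · rcases neg_one_pow_eq_or ℝ (j.1 : ℕ) with h' | h' <;> simp [signFlip, h, pow_succ, h']
  · have : N.matV lam i j = 0 := by simp [matV, bigW, h]
    simp [this]

end Scaling

section Certificate

variable {N : FTN n L m} {γ μ : ℝ} {lam : HiddenIdx L m → ℝ}

/-- From Y = UᵀΛ and Λ = Ψ²/2, Y is √(γ/2) SᵀΨ; the constants meet in √(γ/2) / √(2γ) = 1/2. -/
lemma bigY_mulVec (hγ : 0 < γ) (hN : N.Certified γ lam) (w : HiddenIdx L m → ℝ) :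
    N.bigY *ᵥ w = Real.sqrt (γ / 2) • ((N.matS γ lam)ᵀ *ᵥ fun i => psi lam i * w i) := by
  have h2 : Real.sqrt (γ / 2) * (1 / Real.sqrt (2 * γ)) = 1 / 2 := by
    rw [show 2 * γ = 2 ^ 2 * (γ / 2) by ring, Real.sqrt_mul (by norm_num), Real.sqrt_sq (by norm_num)]
    have : 0 < Real.sqrt (γ / 2) := by positivity
    field_simp
  rw [hN.Y_eq, matS, transpose_smul, smul_mulVec, smul_smul, h2, transpose_mul,
    diagonal_transpose, ← mulVec_mulVec, ← mulVec_mulVec, ← mulVec_smul]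
  congr 1
  ext i
  rw [Pi.smul_apply, mulVec_diagonal, mulVec_diagonal, smul_eq_mul, ← mul_assoc (psi lam i),
    psi_mul_self hN.lam_pos]
  ring

lemma sqrt_smul_matS_mulVec (hγ : 0 < γ) (x : Fin n → ℝ) (i : HiddenIdx L m) :
    (Real.sqrt (2 * γ) • (N.matS γ lam *ᵥ x)) i = psi lam i * (N.bigU *ᵥ x) i := by
  have : 0 < Real.sqrt (2 * γ) := by positivity
  rw [matS, smul_mulVec, smul_smul, mul_one_div_cancel this.ne', one_smul, ← mulVec_mulVec,
    mulVec_diagonal]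

/-- The certificate in rescaled form: `I - (V + Vᵀ) / 2 ⪰ S Sᵀ`. -/
lemma dotProduct_matS_le (hγ : 0 < γ) (hN : N.Certified γ lam) (x : HiddenIdx L m → ℝ) :
    ((N.matS γ lam)ᵀ *ᵥ x) ⬝ᵥ ((N.matS γ lam)ᵀ *ᵥ x)
      ≤ x ⬝ᵥ x - x ⬝ᵥ (N.matV lam *ᵥ x) := by
  obtain ⟨w, hw⟩ : ∃ w : HiddenIdx L m → ℝ, w = fun i => (psi lam i)⁻¹ * x i := ⟨_, rfl⟩
  have hx : ∀ i, x i = psi lam i * w i := fun i => by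
    have := (psi_pos hN.lam_pos i).ne'
    rw [hw]
    field_simp
  have h := hN.sdp.dotProduct_mulVec_nonneg w
  have e1 : w ⬝ᵥ (((2 : ℝ) • diagonal lam) *ᵥ w) = x ⬝ᵥ x := by
    refine Finset.sum_congr rfl fun i _ => ?_
    rw [smul_mulVec, Pi.smul_apply, mulVec_diagonal, hx i, smul_eq_mul]
    linear_combination -(w i * w i) * psi_mul_self hN.lam_pos i
  have e2 : w ⬝ᵥ ((diagonal lam * N.bigW) *ᵥ w) = 1 / 2 * (x ⬝ᵥ (N.matV lam *ᵥ x)) := by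
    rw [dotProduct, dotProduct, Finset.mul_sum]
    refine Finset.sum_congr rfl fun i _ => ?_
    rw [← mulVec_mulVec, mulVec_diagonal, matV_mulVec, ← hw, hx i]
    linear_combination -(1 / 2 * w i * (N.bigW *ᵥ w) i) * psi_mul_self hN.lam_pos i
  have e3 : w ⬝ᵥ ((N.bigWᵀ * diagonal lam) *ᵥ w) = 1 / 2 * (x ⬝ᵥ (N.matV lam *ᵥ x)) := by
    rw [← e2, dotProduct_comm, ← diagonal_transpose, ← transpose_mul, mulVec_transpose,
      ← dotProduct_mulVec]
    simp
  have e4 : w ⬝ᵥ (((2 / γ) • (N.bigYᵀ * N.bigY)) *ᵥ w)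
      = ((N.matS γ lam)ᵀ *ᵥ x) ⬝ᵥ ((N.matS γ lam)ᵀ *ᵥ x) := by
    rw [smul_mulVec, dotProduct_smul, ← mulVec_mulVec, mulVec_transpose, dotProduct_comm,
      ← dotProduct_mulVec, bigY_mulVec hγ hN, ← funext hx, smul_dotProduct, dotProduct_smul,
      smul_eq_mul, smul_eq_mul, smul_eq_mul, ← mul_assoc (√(γ / 2)),
      Real.mul_self_sqrt (by positivity)]
    field_simp
  simp only [star_trivial, sub_mulVec, dotProduct_sub] at h
  rw [e1, e2, e3, e4] at h
  linarith

/-- `S Sᵀ ⪯ 2 I`, because `V` is strictly block subdiagonal. -/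
lemma dotProduct_matS_le_two (hγ : 0 < γ) (hN : N.Certified γ lam) (x : HiddenIdx L m → ℝ) :
    ((N.matS γ lam)ᵀ *ᵥ x) ⬝ᵥ ((N.matS γ lam)ᵀ *ᵥ x) ≤ 2 * (x ⬝ᵥ x) := by
  have h1 := dotProduct_matS_le hγ hN x
  have h2 := dotProduct_matS_le hγ hN (signFlip x)
  rw [signFlip_dotProduct_self, signFlip_matV] at h2
  linarith [dotProduct_self_nonneg' ((N.matS γ lam)ᵀ *ᵥ signFlip x)]

lemma matC_mulVec (N : FTN n L m) (μ γ : ℝ) (lam z : HiddenIdx L m → ℝ) :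
    N.matC μ γ lam *ᵥ z = (γ / μ) • (N.matS γ lam *ᵥ ((N.matS γ lam)ᵀ *ᵥ z)) := by
  rw [matC, smul_mulVec, mulVec_mulVec]

/-- The bound S Sᵀ ⪯ 2I is transferred to SᵀS by Cauchy–Schwarz: with t = Ss, |t|⁴ = ⟨s, Sᵀt⟩² ≤
2|s|²|t|², so |t|² ≤ 2|s|². -/
lemma cocoercive_matC (hμ : 0 < μ) (hγ : 0 < γ) (hN : N.Certified γ lam) :
    Cocoercive (μ / (2 * γ)) (fun z => N.matC μ γ lam *ᵥ z) := by
  intro z w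
  rw [← mulVec_sub]
  generalize z - w = d
  rw [matC_mulVec]
  obtain ⟨s, hs⟩ : ∃ s, s = (N.matS γ lam)ᵀ *ᵥ d := ⟨_, rfl⟩
  obtain ⟨t, ht⟩ : ∃ t, t = N.matS γ lam *ᵥ s := ⟨_, rfl⟩
  have h1 : t ⬝ᵥ d = s ⬝ᵥ s := by
    rw [ht, hs, dotProduct_comm, dotProduct_mulVec, mulVec_transpose]
  have h2 : t ⬝ᵥ t = s ⬝ᵥ ((N.matS γ lam)ᵀ *ᵥ t) := by
    nth_rw 1 [ht]
    rw [dotProduct_comm, dotProduct_mulVec, mulVec_transpose, dotProduct_comm]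
  have h3 := dotProduct_matS_le_two hγ hN t
  have h4 := sq_dotProduct_le s ((N.matS γ lam)ᵀ *ᵥ t)
  rw [← h2] at h4
  have h5 : t ⬝ᵥ t ≤ 2 * (s ⬝ᵥ s) := by
    by_contra! hlt
    have h0 := dotProduct_self_nonneg' s
    have := mul_le_mul_of_nonneg_left h3 h0
    nlinarith
  rw [← hs, ← ht, smul_dotProduct, smul_dotProduct, dotProduct_smul, h1]
  simp only [smul_eq_mul]
  calc _ = γ / (2 * μ) * (t ⬝ᵥ t) := by field_simp
    _ ≤ γ / (2 * μ) * (2 * (s ⬝ᵥ s)) := by gcongr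
    _ = _ := by field_simp

end Certificate

end FTN

/-! ### Bijectivity of the layer, the equilibrium equation and the resolvent -/

namespace FTN

variable {n L : ℕ} {m : ℕ → ℕ}

section Inverse

variable {N : FTN n L m} {σ : ℝ → ℝ} {γ μ : ℝ} {lam : HiddenIdx L m → ℝ}

/-- The rescaled stacked hidden vector of the input `x`. -/
noncomputable def hiddenHat (N : FTN n L m) (σ : ℝ → ℝ) (lam : HiddenIdx L m → ℝ)
    (x : Fin n → ℝ) : HiddenIdx L m → ℝ :=
  fun i => psi lam i * stack L (N.hidden σ x) i

lemma layer_eq (hγ : 0 < γ) (hN : N.Certified γ lam) (x : Fin n → ℝ) :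
    N.layer σ μ x
      = μ • x + Real.sqrt (γ / 2) • ((N.matS γ lam)ᵀ *ᵥ N.hiddenHat σ lam x) + N.bOut := by
  rw [layer, ← bigY_mulVec_stack, bigY_mulVec hγ hN]
  rfl

lemma layer_eq_iff (hμ : 0 < μ) (hγ : 0 < γ) (hN : N.Certified γ lam) (x y : Fin n → ℝ) :
    N.layer σ μ x = y ↔ x = N.readout μ γ lam y (N.hiddenHat σ lam x) := by
  rw [layer_eq hγ hN, readout]
  constructor
  · rintro rfl
    rw [show ∀ a b c : Fin n → ℝ, a + b + c - c - b = a from fun a b c => by abel, smul_smul,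
      one_div_mul_cancel hμ.ne', one_smul]
  · intro h
    generalize N.hiddenHat σ lam x = z at *
    rw [h, smul_smul, mul_one_div_cancel hμ.ne', one_smul]
    abel

lemma eq_hiddenHat_iff (hγ : 0 < γ) (hlam : ∀ i, 0 < lam i) (x : Fin n → ℝ)
    (z : HiddenIdx L m → ℝ) :
    z = N.hiddenHat σ lam x ↔
      z = sigmaHat σ lam (N.matV lam *ᵥ z + Real.sqrt (2 * γ) • (N.matS γ lam *ᵥ x)
        + diagonal (psi lam) *ᵥ N.bigB) := by
  have hne : ∀ i, psi lam i ≠ 0 := fun i => (psi_pos hlam i).ne'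
  have h := N.eq_stack_hidden_iff σ x fun i => (psi lam i)⁻¹ * z i
  have e : z = N.hiddenHat σ lam x ↔
      (fun i => (psi lam i)⁻¹ * z i) = stack L (N.hidden σ x) := by
    rw [funext_iff, funext_iff]
    exact forall_congr' fun i => (inv_mul_eq_iff_eq_mul₀ (hne i)).symm
  rw [e, h, funext_iff]
  refine forall_congr' fun i => ?_
  rw [inv_mul_eq_iff_eq_mul₀ (hne i), sigmaHat, Pi.add_apply, Pi.add_apply, matV_mulVec,
    sqrt_smul_matS_mulVec hγ, mulVec_diagonal, ← mul_add, ← mul_add, inv_mul_cancel_left₀ (hne i)]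

/-- Substituting the readout for x in the implicit equation of the hidden state produces the term
-(γ/μ) S Sᵀ z, as √(2γ) · √(γ/2) = γ. -/
lemma isInverseState_iff (hγ : 0 < γ) (hlam : ∀ i, 0 < lam i) (y : Fin n → ℝ)
    (z : HiddenIdx L m → ℝ) :
    N.IsInverseState σ μ γ lam y z ↔ z = N.hiddenHat σ lam (N.readout μ γ lam y z) := by
  have h2 : Real.sqrt (2 * γ) * (1 / μ) * Real.sqrt (γ / 2) = γ / μ := by
    rw [mul_right_comm, ← Real.sqrt_mul (by positivity), show 2 * γ * (γ / 2) = γ ^ 2 by ring,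
      Real.sqrt_sq hγ.le, mul_one_div]
  rw [eq_hiddenHat_iff hγ hlam, IsInverseState, readout, biasZ, sub_mulVec, matC_mulVec,
    mulVec_smul, mulVec_sub (N.matS γ lam) (y - N.bOut), mulVec_smul, smul_sub, smul_sub, smul_smul,
    smul_smul, smul_smul, h2, mul_one_div]
  have e : ∀ a b c d : HiddenIdx L m → ℝ, a - b + (c + d) = a + (c - b) + d := by
    intros; abel
  rw [e]

lemma slopeRestricted_rescale_psi (hσ : SlopeRestricted σ) (hlam : ∀ i, 0 < lam i)
    (i : HiddenIdx L m) : SlopeRestricted fun t => psi lam i * σ ((psi lam i)⁻¹ * t) :=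
  hσ.rescale (psi_pos hlam i)

lemma exists_properConvex_isProx_sigmaHat (hσ : SlopeRestricted σ) (hlam : ∀ i, 0 < lam i) :
    ∃ f : (HiddenIdx L m → ℝ) → EReal, ProperConvex f ∧ ∀ v, IsProx f 1 v (sigmaHat σ lam v) :=
  exists_properConvex_isProx (s := fun i t => psi lam i * σ ((psi lam i)⁻¹ * t))
    (slopeRestricted_rescale_psi hσ hlam)

lemma existsUnique_isProx_of_sigmaHat (hσ : SlopeRestricted σ) (hlam : ∀ i, 0 < lam i)
    {f : (HiddenIdx L m → ℝ) → EReal} (hf : ProperConvex f)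
    (hf1 : ∀ v, IsProx f 1 v (sigmaHat σ lam v)) {α : ℝ} (hα : 0 < α) (v : HiddenIdx L m → ℝ) :
    ∃! p, IsProx f α v p :=
  existsUnique_isProx (s := fun i t => psi lam i * σ ((psi lam i)⁻¹ * t))
    (slopeRestricted_rescale_psi hσ hlam) hf hf1 hα v

lemma firmlyNonexpansive_sigmaHat (hσ : SlopeRestricted σ) (hlam : ∀ i, 0 < lam i) :
    FirmlyNonexpansive (sigmaHat σ lam) := by
  intro u v
  refine Finset.sum_le_sum fun i _ => ?_
  have := slopeRestricted_iff.1 (slopeRestricted_rescale_psi hσ hlam i) (u i) (v i)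
  simpa [sigmaHat, sq] using this

/-- The nonlinear part of a certified layer is cocoercive. -/
lemma cocoercive_residual (hσ : SlopeRestricted σ) (hγ : 0 < γ) (hN : N.Certified γ lam)
    (x x' : Fin n → ℝ) :
    let G := fun x => Real.sqrt (γ / 2) • ((N.matS γ lam)ᵀ *ᵥ N.hiddenHat σ lam x)
    (G x - G x') ⬝ᵥ (G x - G x') ≤ γ * ((G x - G x') ⬝ᵥ (x - x')) := by
  intro G
  have h := (eq_hiddenHat_iff hγ hN.lam_pos x (N.hiddenHat σ lam x)).1 rfl
  have h' := (eq_hiddenHat_iff hγ hN.lam_pos x' (N.hiddenHat σ lam x')).1 rfl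
  have hf := firmlyNonexpansive_sigmaHat hσ hN.lam_pos
    (N.matV lam *ᵥ N.hiddenHat σ lam x + Real.sqrt (2 * γ) • (N.matS γ lam *ᵥ x)
        + diagonal (psi lam) *ᵥ N.bigB)
    (N.matV lam *ᵥ N.hiddenHat σ lam x' + Real.sqrt (2 * γ) • (N.matS γ lam *ᵥ x')
        + diagonal (psi lam) *ᵥ N.bigB)
  rw [← h, ← h', add_sub_add_right_eq_sub, add_sub_add_comm, ← mulVec_sub, ← smul_sub,
    ← mulVec_sub, dotProduct_add, dotProduct_smul] at hf
  have hG : G x - G x' = Real.sqrt (γ / 2) •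
      ((N.matS γ lam)ᵀ *ᵥ (N.hiddenHat σ lam x - N.hiddenHat σ lam x')) := by
    simp only [G]
    rw [← smul_sub, ← mulVec_sub]
  rw [hG]
  generalize N.hiddenHat σ lam x - N.hiddenHat σ lam x' = d at hf ⊢
  generalize x - x' = r at hf ⊢
  have h1 := dotProduct_matS_le hγ hN d
  rw [dotProduct_mulVec d (N.matS γ lam), ← mulVec_transpose] at hf
  generalize (N.matS γ lam)ᵀ *ᵥ d = s at *
  rw [smul_dotProduct, smul_dotProduct, dotProduct_smul]
  simp only [smul_eq_mul] at hf ⊢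
  rw [← mul_assoc, Real.mul_self_sqrt (by positivity)]
  rw [show 2 * γ = 2 ^ 2 * (γ / 2) by ring, Real.sqrt_mul (by norm_num),
    Real.sqrt_sq (by norm_num)] at hf
  -- Firm nonexpansiveness bounds |d|² - ⟨d, Vd⟩ from above, the certificate bounds it from below by
  -- |s|².
  have h2 : s ⬝ᵥ s ≤ 2 * Real.sqrt (γ / 2) * s ⬝ᵥ r := by linarith
  calc _ ≤ γ / 2 * (2 * Real.sqrt (γ / 2) * s ⬝ᵥ r) := by gcongr
    _ = _ := by ring

/-- A certified layer is bijective. -/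
lemma existsUnique_layer_eq (hσ : SlopeRestricted σ) (hμ : 0 < μ) (hγ : 0 < γ)
    (hN : N.Certified γ lam) (y : Fin n → ℝ) : ∃! x, N.layer σ μ x = y := by
  obtain ⟨G, hG⟩ : ∃ G : (Fin n → ℝ) → Fin n → ℝ,
    G = fun x => Real.sqrt (γ / 2) • ((N.matS γ lam)ᵀ *ᵥ N.hiddenHat σ lam x) := ⟨_, rfl⟩
  have hl : ∀ x, N.layer σ μ x = μ • x + G x + N.bOut := fun x => by rw [layer_eq hγ hN, hG]
  have hcoc : ∀ x x', (G x - G x') ⬝ᵥ (G x - G x') ≤ γ * ((G x - G x') ⬝ᵥ (x - x')) := by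
    intro x x'
    have := cocoercive_residual hσ hγ hN x x'
    rw [hG]
    exact this
  -- The step 2/(μ + ν), for which the cross term and the cocoercivity bound on t²|g|² cancel
  -- (`htg`), leaving the contraction factor 1 - tμ.
  obtain ⟨t, ht⟩ : ∃ t : ℝ, t = 2 / (2 * μ + γ) := ⟨_, rfl⟩
  have hden : 0 < 2 * μ + γ := by positivity
  have ht0 : 0 < t := by rw [ht]; positivity
  have htg : t * γ = 2 * (1 - t * μ) := by rw [ht]; field_simp; ring
  have hT : ∀ x x' : Fin n → ℝ,
      ((x - t • (N.layer σ μ x - y)) - (x' - t • (N.layer σ μ x' - y))) ⬝ᵥ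
        ((x - t • (N.layer σ μ x - y)) - (x' - t • (N.layer σ μ x' - y)))
      ≤ (1 - t * μ) ^ 2 * ((x - x') ⬝ᵥ (x - x')) := by
    intro x x'
    have e : (x - t • (N.layer σ μ x - y)) - (x' - t • (N.layer σ μ x' - y))
        = (1 - t * μ) • (x - x') - t • (G x - G x') := by
      rw [hl, hl]
      module
    rw [e]
    have h := hcoc x x'
    generalize x - x' = r at h ⊢
    generalize G x - G x' = g at h ⊢
    simp only [sub_dotProduct, dotProduct_sub, smul_dotProduct, dotProduct_smul, smul_eq_mul]
    rw [dotProduct_comm r g]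
    have h1 := mul_le_mul_of_nonneg_left h (sq_nonneg t)
    have h2 : t ^ 2 * (γ * g ⬝ᵥ r) = 2 * t * (1 - t * μ) * g ⬝ᵥ r := by
      linear_combination t * (g ⬝ᵥ r) * htg
    rw [h2] at h1
    linarith
  have hc0 : 0 < 1 - t * μ := by have := mul_pos ht0 hγ; linarith
  have hc1 : 1 - t * μ < 1 := by have := mul_pos ht0 hμ; linarith
  have hfix : ∀ x, x - t • (N.layer σ μ x - y) = x ↔ N.layer σ μ x = y := fun x => by
    rw [sub_eq_self, smul_eq_zero, or_iff_right ht0.ne', sub_eq_zero]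
  obtain ⟨x, hx⟩ := exists_fixedPoint_of_dotProduct_contraction hc0.le hc1
    (fun x => x - t • (N.layer σ μ x - y)) hT
  refine ⟨x, (hfix x).1 hx, fun x' hx' => ?_⟩
  have h := hT x' x
  rw [(hfix x').2 hx', hx] at h
  apply eq_of_dotProduct_sub_self_nonpos
  by_contra! hpos
  have := mul_lt_mul_of_pos_right (pow_lt_one₀ hc0.le hc1 two_ne_zero) hpos
  linarith

end Inverse

section Resolvent

variable {N : FTN n L m} {γ α : ℝ} {lam : HiddenIdx L m → ℝ}

lemma dotProduct_matV_le (hγ : 0 < γ) (hN : N.Certified γ lam) (x : HiddenIdx L m → ℝ) :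
    x ⬝ᵥ (N.matV lam *ᵥ x) ≤ x ⬝ᵥ x := by
  linarith [dotProduct_matS_le hγ hN x, dotProduct_self_nonneg' ((N.matS γ lam)ᵀ *ᵥ x)]

lemma resolvent_mulVec (V : Matrix (HiddenIdx L m) (HiddenIdx L m) ℝ) (α : ℝ)
    (x : HiddenIdx L m → ℝ) :
    ((1 + α) • (1 : Matrix (HiddenIdx L m) (HiddenIdx L m) ℝ) - α • V) *ᵥ x
      = (1 + α) • x - α • (V *ᵥ x) := by
  rw [sub_mulVec, smul_mulVec, smul_mulVec, one_mulVec]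

/-- Coercivity with constant 1 gives both the invertibility of this matrix and the firm
nonexpansiveness of the resolvent. -/
lemma dotProduct_self_le_resolvent (hγ : 0 < γ) (hN : N.Certified γ lam) (hα : 0 < α)
    (x : HiddenIdx L m → ℝ) :
    x ⬝ᵥ x ≤ x ⬝ᵥ (((1 + α) • (1 : Matrix (HiddenIdx L m) (HiddenIdx L m) ℝ)
      - α • N.matV lam) *ᵥ x) := by
  rw [resolvent_mulVec, dotProduct_sub, dotProduct_smul, dotProduct_smul, smul_eq_mul, smul_eq_mul]
  nlinarith [mul_le_mul_of_nonneg_left (dotProduct_matV_le hγ hN x) hα.le]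

lemma isUnit_det_resolvent (hγ : 0 < γ) (hN : N.Certified γ lam) (hα : 0 < α) :
    IsUnit ((1 + α) • (1 : Matrix (HiddenIdx L m) (HiddenIdx L m) ℝ) - α • N.matV lam).det := by
  rw [isUnit_iff_ne_zero]
  intro h0
  obtain ⟨x, hx, hx0⟩ := exists_mulVec_eq_zero_iff.2 h0
  have := dotProduct_self_le_resolvent hγ hN hα x
  rw [hx0, dotProduct_zero] at this
  exact hx (dotProduct_self_eq_zero.1 (le_antisymm this (dotProduct_self_nonneg' x)))

lemma mulVec_resolventA (hγ : 0 < γ) (hN : N.Certified γ lam) (hα : 0 < α)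
    (bz v : HiddenIdx L m → ℝ) :
    ((1 + α) • (1 : Matrix (HiddenIdx L m) (HiddenIdx L m) ℝ) - α • N.matV lam) *ᵥ
      resolventA α (N.matV lam) bz v = v + α • bz := by
  rw [resolventA, mulVec_mulVec, mul_nonsing_inv _ (isUnit_det_resolvent hγ hN hα), one_mulVec]

lemma resolventA_eq_iff (hγ : 0 < γ) (hN : N.Certified γ lam) (hα : 0 < α)
    (bz v z : HiddenIdx L m → ℝ) :
    resolventA α (N.matV lam) bz v = z ↔ (1 + α) • z - α • (N.matV lam *ᵥ z) = v + α • bz := by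
  rw [← resolvent_mulVec]
  constructor
  · rintro rfl
    exact mulVec_resolventA hγ hN hα bz v
  · intro h
    rw [resolventA, ← h, mulVec_mulVec, nonsing_inv_mul _ (isUnit_det_resolvent hγ hN hα),
      one_mulVec]

lemma firmlyNonexpansive_resolventA (hγ : 0 < γ) (hN : N.Certified γ lam) (hα : 0 < α)
    (bz : HiddenIdx L m → ℝ) : FirmlyNonexpansive (resolventA α (N.matV lam) bz) := by
  intro u v
  have h := dotProduct_self_le_resolvent hγ hN hα
    (resolventA α (N.matV lam) bz u - resolventA α (N.matV lam) bz v)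
  rwa [mulVec_sub, mulVec_resolventA hγ hN hα, mulVec_resolventA hγ hN hα,
    add_sub_add_right_eq_sub] at h

end Resolvent

end FTN

/-! ### Existence and convergence of the Davis–Yin iteration -/

section Splitting

variable {ι : Type*} [Fintype ι] [DecidableEq ι]

lemma exists_isDavisYin {f : (ι → ℝ) → EReal} {α : ℝ} {J : (ι → ℝ) → ι → ℝ}
    (hJ : ∀ v, IsProx f α v (J v)) (V C : Matrix ι ι ℝ) (bz u₀ : ι → ℝ) :
    ∃ u zHalf uHalf z : ℕ → ι → ℝ, u 0 = u₀ ∧ IsDavisYin f α V C bz u zHalf uHalf z := by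
  let R : (ι → ℝ) → ι → ℝ := fun x =>
    resolventA α V bz ((2 : ℝ) • J x - x - α • (C *ᵥ J x))
  let u : ℕ → ι → ℝ := fun k => (fun x => x + R x - J x)^[k] u₀
  -- With truncated subtraction, z 0 gets the irrelevant value R (u 0), and z (k + 1) = R (u k) as
  -- required.
  exact ⟨u, fun k => J (u k), fun k => (2 : ℝ) • J (u k) - u k, fun k => R (u (k - 1)), rfl,
    fun k => hJ _, fun k => rfl, fun k => rfl,
    fun k => Function.iterate_succ_apply' (fun x => x + R x - J x) k u₀⟩

/-- Convergence of Davis–Yin splitting when the fixed point is unique. -/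
lemma IsDavisYin.tendsto {f : (ι → ℝ) → EReal} (hf : ProperConvex f) {α β : ℝ} (hα : 0 < α)
    (hαβ : α < 2 * β) {J : (ι → ℝ) → ι → ℝ} (hJ : ∀ v, IsProx f α v (J v))
    {V C : Matrix ι ι ℝ} {bz : ι → ℝ} (hR : FirmlyNonexpansive (resolventA α V bz))
    (hC : Cocoercive β fun z => C *ᵥ z) {a : ι → ℝ}
    (ha : ∀ x, resolventA α V bz ((2 : ℝ) • J x - x - α • (C *ᵥ J x)) = J x ↔ x = a)
    {u zHalf uHalf z : ℕ → ι → ℝ} (h : IsDavisYin f α V C bz u zHalf uHalf z) :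
    Tendsto u atTop (𝓝 a) ∧ Tendsto zHalf atTop (𝓝 (J a)) ∧ Tendsto z atTop (𝓝 (J a)) := by
  have hJf := isProx_firmlyNonexpansive hf hα hJ
  have hJc := hJf.continuous
  have hRc := hR.continuous
  have hz : zHalf = fun k => J (u k) := funext fun k => (h.zHalf_prox k).unique hf hα (hJ _)
  have hβ : 0 < β := by linarith
  have hu : Tendsto u atTop (𝓝 a) := by
    refine tendsto_of_fejer
      (T := fun x => x + resolventA α V bz ((2 : ℝ) • J x - x - α • (C *ᵥ J x)) - J x)
      ?_ (fun x hx => (ha x).1 ?_) (δ := 1 - α / (2 * β)) ?_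
      (davisYin_fejer hJf hR hβ hα hC ((ha a).2 rfl)) fun k => ?_
    · have hlin : Continuous fun x => C *ᵥ J x :=
        (Continuous.matrix_mulVec continuous_const hJc)
      fun_prop
    · rwa [add_sub_assoc, add_eq_left, sub_eq_zero] at hx
    · rw [sub_pos, div_lt_one (by positivity)]
      exact hαβ
    · rw [h.u_succ, h.z_succ, h.uHalf_eq, hz]
  have hzH : Tendsto zHalf atTop (𝓝 (J a)) := by
    rw [hz]
    exact (hJc.tendsto a).comp hu
  refine ⟨hu, hzH, (tendsto_add_atTop_iff_nat 1).1 ?_⟩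
  have e : (fun k => z (k + 1)) = fun k => u (k + 1) - u k + zHalf k := funext fun k => by
    rw [h.u_succ]
    abel
  rw [e]
  simpa using (((tendsto_add_atTop_iff_nat 1).2 hu).sub hu).add hzH

end Splitting

/-! ### Fixed points of the iteration and the main theorem -/

namespace FTN

variable {n L : ℕ} {m : ℕ → ℕ}

lemma continuous_readout (N : FTN n L m) (μ γ : ℝ) (lam : HiddenIdx L m → ℝ) (y : Fin n → ℝ) :
    Continuous (N.readout μ γ lam y) := by
  have : Continuous fun z : HiddenIdx L m → ℝ => (N.matS γ lam)ᵀ *ᵥ z :=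
    Continuous.matrix_mulVec continuous_const continuous_id
  unfold FTN.readout
  fun_prop

/-- The Davis–Yin iteration has a unique fixed point, and its proximal point is the solution of the
equilibrium equation. -/
lemma exists_davisYin_fixedPoint {N : FTN n L m} {σ : ℝ → ℝ} {μ γ α : ℝ}
    {lam : HiddenIdx L m → ℝ} {y : Fin n → ℝ} {zs : HiddenIdx L m → ℝ}
    (hγ : 0 < γ) (hN : N.Certified γ lam) {f : (HiddenIdx L m → ℝ) → EReal}
    (hf : ProperConvex f) (hf1 : ∀ v, IsProx f 1 v (sigmaHat σ lam v)) (hα : 0 < α)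
    {J : (HiddenIdx L m → ℝ) → HiddenIdx L m → ℝ} (hJ : ∀ v, IsProx f α v (J v))
    (hzs : N.IsInverseState σ μ γ lam y zs)
    (hzuniq : ∀ z, N.IsInverseState σ μ γ lam y z → z = zs) :
    ∃ us, J us = zs ∧ ∀ x, resolventA α (N.matV lam) (N.biasZ μ γ lam y)
      ((2 : ℝ) • J x - x - α • (N.matC μ γ lam *ᵥ J x)) = J x ↔ x = us := by
  have hfix : ∀ x, resolventA α (N.matV lam) (N.biasZ μ γ lam y)
      ((2 : ℝ) • J x - x - α • (N.matC μ γ lam *ᵥ J x)) = J x ↔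
      x = J x + α • ((N.matV lam - N.matC μ γ lam) *ᵥ J x + N.biasZ μ γ lam y - J x) := fun x => by
    rw [resolventA_eq_iff hγ hN hα, sub_mulVec]
    generalize N.matV lam *ᵥ J x = p
    generalize N.matC μ γ lam *ᵥ J x = q
    generalize N.biasZ μ γ lam y = b
    generalize J x = z
    rw [← sub_eq_zero, ← sub_eq_zero (a := x)]
    refine Eq.congr_left ?_
    module
  unfold IsInverseState at hzs hzuniq
  obtain ⟨E, hE⟩ : ∃ E : (HiddenIdx L m → ℝ) → HiddenIdx L m → ℝ,
      E = fun z => (N.matV lam - N.matC μ γ lam) *ᵥ z + N.biasZ μ γ lam y := ⟨_, rfl⟩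
  have hEz : ∀ z, (N.matV lam - N.matC μ γ lam) *ᵥ z + N.biasZ μ γ lam y = E z :=
    fun z => by rw [hE]
  simp only [hEz] at hfix hzs hzuniq
  have hJus : J (zs + α • (E zs - zs)) = zs := by
    have h := (hf1 (E zs)).change_parameter hf hα
    rw [← hzs] at h
    exact (hJ _).unique hf hα h
  -- The fixed point is zs + α(E(zs) - zs). Conversely, at a fixed point x the optimality condition
  -- with parameter α, divided by α, is the one with parameter 1 at E(J x), so J x solves the
  -- equilibrium equation.
  refine ⟨_, hJus, fun x => (hfix x).trans ⟨fun hx => ?_, ?_⟩⟩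
  · have hJx : J x = zs := by
      refine hzuniq _ ?_
      have h1 := (isProx_iff hf hα).1 (hJ x)
      refine IsProx.unique hf one_pos ((isProx_iff hf one_pos).2 ⟨h1.1, fun z hz => ?_⟩)
        (hf1 (E (J x)))
      have h2 := h1.2 z hz
      rw [sub_eq_iff_eq_add'.2 hx, smul_dotProduct, smul_eq_mul] at h2
      rw [one_mul]
      exact le_of_mul_le_mul_left h2 hα
    rw [← hJx]
    exact hx
  · rintro rfl
    rw [hJus]

end FTN

theorem mainTheorem6 {n L : ℕ} {m : ℕ → ℕ} (N : FTN n L m) (σ : ℝ → ℝ)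
    (hσ : SlopeRestricted σ) (μ ν γ τ : ℝ) (hμ : 0 < μ) (hμν : μ < ν)
    (hγ : γ = ν - μ) (hτ : τ = ν / μ)
    (lam : HiddenIdx L m → ℝ) (hN : N.Certified γ lam) :
    Cocoercive (μ / (2 * γ)) (fun z => N.matC μ γ lam *ᵥ z) ∧
    (∃ f : (HiddenIdx L m → ℝ) → EReal,
      ProperConvex f ∧ ∀ v, IsProx f 1 v (FTN.sigmaHat σ lam v)) ∧
    ∀ y : Fin n → ℝ, ∃ (xs : Fin n → ℝ) (zs : HiddenIdx L m → ℝ),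
      (N.layer σ μ xs = y ∧ ∀ x, N.layer σ μ x = y → x = xs) ∧
      (N.IsInverseState σ μ γ lam y zs ∧ ∀ z, N.IsInverseState σ μ γ lam y z → z = zs) ∧
      xs = N.readout μ γ lam y zs ∧
      ∀ f : (HiddenIdx L m → ℝ) → EReal, ProperConvex f →
        (∀ v, IsProx f 1 v (FTN.sigmaHat σ lam v)) →
        ∀ α : ℝ, 0 < α → α < 1 / (τ - 1) →
          (∀ v, ∃! p, IsProx f α v p) ∧
          IsUnit ((1 + α) • (1 : Matrix (HiddenIdx L m) (HiddenIdx L m) ℝ)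
            - α • N.matV lam).det ∧
          (∀ u₀ : HiddenIdx L m → ℝ, ∃ u zHalf uHalf z : ℕ → HiddenIdx L m → ℝ, u 0 = u₀ ∧
            IsDavisYin f α (N.matV lam) (N.matC μ γ lam) (N.biasZ μ γ lam y) u zHalf uHalf z) ∧
          ∀ u zHalf uHalf z : ℕ → HiddenIdx L m → ℝ,
            IsDavisYin f α (N.matV lam) (N.matC μ γ lam) (N.biasZ μ γ lam y) u zHalf uHalf z →
            (∃ us : HiddenIdx L m → ℝ, IsProx f α us zs ∧
              resolventA α (N.matV lam) (N.biasZ μ γ lam y)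
                ((2 : ℝ) • zs - us - α • (N.matC μ γ lam *ᵥ zs)) = zs ∧
              Tendsto u atTop (𝓝 us)) ∧
            Tendsto zHalf atTop (𝓝 zs) ∧
            Tendsto z atTop (𝓝 zs) ∧
            Tendsto (fun k => N.readout μ γ lam y (zHalf k)) atTop (𝓝 xs) ∧
            Tendsto (fun k => N.readout μ γ lam y (z k)) atTop (𝓝 xs) := by
  have hγ0 : 0 < γ := by rw [hγ]; linarith
  have hC := FTN.cocoercive_matC hμ hγ0 hN
  refine ⟨hC, FTN.exists_properConvex_isProx_sigmaHat hσ hN.lam_pos, fun y => ?_⟩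
  obtain ⟨xs, hxs, huniq⟩ := FTN.existsUnique_layer_eq hσ hμ hγ0 hN y
  have hread := (FTN.layer_eq_iff hμ hγ0 hN xs y).1 hxs
  have hzs : N.IsInverseState σ μ γ lam y (N.hiddenHat σ lam xs) := by
    rw [FTN.isInverseState_iff hγ0 hN.lam_pos, ← hread]
  -- The readout of any equilibrium state solves F(x) = y, hence is `xs`, and the state is recovered
  -- from it.
  have hzuniq : ∀ z, N.IsInverseState σ μ γ lam y z → z = N.hiddenHat σ lam xs := fun z hz => by
    rw [FTN.isInverseState_iff hγ0 hN.lam_pos] at hz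
    rw [hz, ← huniq _ ((FTN.layer_eq_iff hμ hγ0 hN _ y).2 (by rw [← hz]))]
  generalize N.hiddenHat σ lam xs = zs at hread hzs hzuniq
  refine ⟨xs, zs, ⟨hxs, huniq⟩, ⟨hzs, hzuniq⟩, hread, fun f hf hf1 α hα hατ => ?_⟩
  have hαβ : α < 2 * (μ / (2 * γ)) := by
    have e : 1 / (τ - 1) = 2 * (μ / (2 * γ)) := by
      have : τ - 1 = γ / μ := by rw [hτ, hγ]; field_simp
      rw [this]
      field_simp
    rwa [e] at hατ
  have hprox := FTN.existsUnique_isProx_of_sigmaHat hσ hN.lam_pos hf hf1 hα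
  choose J hJ hJu using hprox
  have hR := FTN.firmlyNonexpansive_resolventA hγ0 hN hα (N.biasZ μ γ lam y)
  obtain ⟨us, hJus, hfix⟩ := FTN.exists_davisYin_fixedPoint hγ0 hN hf hf1 hα hJ hzs hzuniq
  refine ⟨fun v => ⟨J v, hJ v, hJu v⟩, FTN.isUnit_det_resolvent hγ0 hN hα,
    exists_isDavisYin hJ _ _ _, fun u zHalf uHalf z h => ?_⟩
  obtain ⟨h1, h2, h3⟩ := h.tendsto hf hα hαβ hJ hR hC hfix
  rw [hJus] at h2 h3
  have hlim := (N.continuous_readout μ γ lam y).tendsto zs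
  rw [← hread] at hlim
  refine ⟨⟨us, hJus ▸ hJ us, ?_, h1⟩, h2, h3, hlim.comp h2, hlim.comp h3⟩
  have := (hfix us).2 rfl
  rwa [hJus] at this
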